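/- Let $\mathcal C$ be a model category (for instance a simplicial model category), let $\eta\colon k\to B$ be a morphism of $\mathcal C$, and let $\mathcal C^\eta$ be the category of factorizations $k\to X\to B$ of $\eta$, in which a morphism is a weak equivalence, a cofibration or a fibration if the underlying morphism of $\mathcal C$ is one; its terminal object $k\xrightarrow{\eta}B\xrightarrow{=}B$ is again denoted $B$. Let $R$ be a commutative ring and let $\mathrm{Ch}(R)$ be the category of unbounded chain complexes of $R$-modules, with the quasi-isomorphisms as weak equivalences. For a chain complex $K$ let $\Omega K$ be the loop complex $(\Omega K)_i=K_{i+1}$ with differential $-d$. For $X\in\mathcal C^\eta$ let $\Sigma_BX=\operatorname{hocolim}(B\leftarrow X\to B)$, the homotopy colimit being formed in $\mathcal C^\eta$ (it is well defined up to weak equivalence), and let $\Sigma_B^1X=\Sigma_BX$ and $\Sigma_B^nX=\Sigma_B(\Sigma_B^{n-1}X)$ for $n\ge 2$. Let $F\colon\mathcal C^\eta\to\mathrm{Ch}(R)$ be a functor that is reduced, i.e. $F(B)\simeq 0$, and $1$-excisive, i.e. $F$ takes homotopy cocartesian squares in $\mathcal C^\eta$ to homotopy cartesian squares in $\mathrm{Ch}(R)$.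 Then for every object $X$ of $\mathcal C^\eta$ and every $n\ge 1$, an object $\Sigma_B^nX$ exists, and for every choice of models for the homotopy colimits that define it, there is a weak equivalence of chain complexes (a finite zigzag of quasi-isomorphisms) $$F(X)\simeq\Omega^nF(\Sigma_B^nX).$$ -/

import Mathlib

open CategoryTheory Limits HomotopicalAlgebra

universe w v u r

namespace Deloop

/-- Two objects are weakly equivalent, with respect to a class `W` of weak equivalences, if they
are connected by a finite zigzag of morphisms in `W`. -/
def WeaklyEquivalent {D : Type u} [Category.{v} D] (W : MorphismProperty D) (X Y : D) : Prop :=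
  Relation.EqvGen (fun X Y : D => ∃ f : X ⟶ Y, W f) X Y

/-! ### The category of factorizations of a morphism, with the inherited model structure

For `η : k ⟶ B` the category `Factorisation η` has the diagrams `k ⟶ X ⟶ B` with composite `η` as
objects. A morphism in it is a weak equivalence, a cofibration or a fibration if the underlying
morphism of `C` is one. -/

section Factorization

variable {C : Type u} [Category.{v} C] {k B : C} (η : k ⟶ B)

instance [CategoryWithWeakEquivalences C] :
    CategoryWithWeakEquivalences (Factorisation η) where
  weakEquivalences := (weakEquivalences C).inverseImage Factorisation.forget

instance [CategoryWithCofibrations C] : CategoryWithCofibrations (Factorisation η) where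
  cofibrations := (cofibrations C).inverseImage Factorisation.forget

instance [CategoryWithFibrations C] : CategoryWithFibrations (Factorisation η) where
  fibrations := (fibrations C).inverseImage Factorisation.forget

end Factorization

/-! ### Homotopy pushouts -/

section HomotopyPushout

variable {D : Type u} [Category.{v} D] [CategoryWithWeakEquivalences D]
  [CategoryWithCofibrations D] [HasInitial D]

/-- A cofibrant replacement of the span `Y ⟵ X ⟶ Z`: a span of two cofibrations out of a
cofibrant object, with an objectwise weak equivalence to the given span. -/
structure SpanReplacement {X Y Z : D} (f : X ⟶ Y) (g : X ⟶ Z) where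
  /-- the replacement of the common source -/
  X' : D
  /-- the replacement of the first target -/
  Y' : D
  /-- the replacement of the second target -/
  Z' : D
  /-- the first leg -/
  f' : X' ⟶ Y'
  /-- the second leg -/
  g' : X' ⟶ Z'
  /-- the comparison morphism at the common source -/
  wX : X' ⟶ X
  /-- the comparison morphism at the first target -/
  wY : Y' ⟶ Y
  /-- the comparison morphism at the second target -/
  wZ : Z' ⟶ Z
  comm_f : f' ≫ wY = wX ≫ f
  comm_g : g' ≫ wZ = wX ≫ g
  isCofibrant : IsCofibrant X'
  cofibration_f' : Cofibration f'
  cofibration_g' : Cofibration g'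
  weakEquivalence_wX : WeakEquivalence wX
  weakEquivalence_wY : WeakEquivalence wY
  weakEquivalence_wZ : WeakEquivalence wZ

/-- `H` is (a model of) the homotopy colimit of the span `Y ⟵ X ⟶ Z`: it is weakly equivalent to
the pushout of a cofibrant replacement of the span. -/
def IsHocolimSpan {X Y Z : D} (f : X ⟶ Y) (g : X ⟶ Z) (H : D) : Prop :=
  ∃ (S : SpanReplacement f g) (P : D) (inl : S.Y' ⟶ P) (inr : S.Z' ⟶ P),
    IsPushout S.f' S.g' inl inr ∧ WeaklyEquivalent (weakEquivalences D) P H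

/-- The square
```
  X --f--> Y
  |        |
  g        h
  v        v
  Z --l--> T
```
is homotopy cocartesian: it commutes, and the morphism induced from the homotopy colimit of
`Y ⟵ X ⟶ Z` to `T` is a weak equivalence. -/
def IsHomotopyCocartesian {X Y Z T : D} (f : X ⟶ Y) (g : X ⟶ Z) (h : Y ⟶ T) (l : Z ⟶ T) : Prop :=
  CommSq f g h l ∧
    ∃ (S : SpanReplacement f g) (P : D) (inl : S.Y' ⟶ P) (inr : S.Z' ⟶ P) (q : P ⟶ T),
      IsPushout S.f' S.g' inl inr ∧ inl ≫ q = S.wY ≫ h ∧ inr ≫ q = S.wZ ≫ l ∧ WeakEquivalence q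

end HomotopyPushout

/-! ### Fiberwise suspension -/

section Suspension

variable {C : Type u} [Category.{v} C] [ModelCategory C] {k B : C} {η : k ⟶ B}

/-- `Y` is (a model of) `Σ_B X = hocolim (B ⟵ X ⟶ B)`, the homotopy colimit being taken in the
category of factorizations of `η : k ⟶ B`, whose terminal object is `k ⟶ B = B`. -/
def IsSuspension (X Y : Factorisation η) : Prop :=
  IsHocolimSpan (Factorisation.IsTerminal_terminal.from X)
    (Factorisation.IsTerminal_terminal.from X) Y

/-- `Y` is (a model of) the `n`-fold suspension `Σ_B^n X`. -/
def IsIteratedSuspension : ℕ → Factorisation η → Factorisation η → Prop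
  | 0, X, Y => X = Y
  | n + 1, X, Y => ∃ Z, IsIteratedSuspension n X Z ∧ IsSuspension Z Y

end Suspension

/-! ### Chain complexes -/

section ChainComplexes

variable {R : Type u} [CommRing R]

/-- The loop complex `(Ω K)_i = K_{i+1}`, with differential `-d`, which is the homotopy fiber
of `0 ⟶ K`. -/
def loop (K : ChainComplex (ModuleCat.{w} R) ℤ) : ChainComplex (ModuleCat.{w} R) ℤ where
  X i := K.X (i + 1)
  d i j := -K.d (i + 1) (j + 1)
  shape i j hij := by
    rw [K.shape, neg_zero]
    intro h
    apply hij
    simp only [ComplexShape.down_Rel] at h ⊢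
    omega
  d_comp_d' i j l _ _ := by simp

/-- The square
```
  A --f--> B
  |        |
  g        h
  v        v
  C --l--> D
```
of chain complexes is homotopy cartesian: it commutes, and for a factorization of `l` into a
quasi-isomorphism `i : C ⟶ C'` and a levelwise surjection (that is, a fibration) `p : C' ⟶ D`, the
induced morphism from `A` to the pullback `P` of `h` and `p`, which is the homotopy pullback of
`C ⟶ D ⟵ B`, is a quasi-isomorphism. -/
def IsHomotopyCartesian {A B C D : ChainComplex (ModuleCat.{w} R) ℤ}
    (f : A ⟶ B) (g : A ⟶ C) (h : B ⟶ D) (l : C ⟶ D) : Prop :=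
  CommSq f g h l ∧
    ∃ (C' P : ChainComplex (ModuleCat.{w} R) ℤ) (i : C ⟶ C') (p : C' ⟶ D)
      (a : P ⟶ B) (b : P ⟶ C') (q : A ⟶ P),
      i ≫ p = l ∧ QuasiIso i ∧ (∀ n : ℤ, Epi (p.f n)) ∧ IsPullback a b h p ∧
        q ≫ a = f ∧ q ≫ b = g ≫ i ∧ QuasiIso q

end ChainComplexes

/-! ### Reduced and 1-excisive functors -/

section Functors

variable {C : Type u} [Category.{v} C] [ModelCategory C] {k B : C} {η : k ⟶ B}
  {R : Type r} [CommRing R]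

/-- `F` is reduced: `F(B) ≃ 0`. -/
def IsReduced (F : Factorisation η ⥤ ChainComplex (ModuleCat.{w} R) ℤ) : Prop :=
  (F.obj Factorisation.terminal).Acyclic

/-- `F` is 1-excisive: it takes homotopy cocartesian squares to homotopy cartesian squares. -/
def IsOneExcisive (F : Factorisation η ⥤ ChainComplex (ModuleCat.{w} R) ℤ) : Prop :=
  ∀ ⦃X Y Z T : Factorisation η⦄ (f : X ⟶ Y) (g : X ⟶ Z) (h : Y ⟶ T) (l : Z ⟶ T),
    IsHomotopyCocartesian f g h l →
      IsHomotopyCartesian (F.map f) (F.map g) (F.map h) (F.map l)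

end Functors

end Deloop

namespace Deloop

/-! ### Short exact sequences of complexes and quasi-isomorphisms -/

section ShortExact

variable {A : Type u} [Category.{v} A] [Abelian A]

/-! Replace the span B ← X → B by cofibrations Y' ← X' → Z' with pushout P. This pushout square is
homotopy cocartesian, so `F` makes it homotopy cartesian. Its corners F(Y') and F(Z') are acyclic,
being quasi-isomorphic to F(B), and a homotopy pullback of acyclic complexes over D is ΩD
(`IsHomotopyCartesian.weaklyEquivalent_loop`). Hence F(X) ≃ ΩF(Σ_B X), and induction on n concludes,
as Ω preserves quasi-isomorphisms. That `F` preserves weak equivalences is not assumed but follows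
from excision (`IsOneExcisive.quasiIso_map`): for a weak equivalence f, the square with sides id,
id, f, f is homotopy cocartesian, and in a homotopy cartesian square the side opposite a
quasi-isomorphism is one. Existence of suspensions only needs factorizations and pushouts, both
inherited from `C`. -/

lemma quasiIso_f_of_acyclic {S : ShortComplex (ChainComplex A ℤ)} (hS : S.ShortExact)
    (h₃ : S.X₃.Acyclic) : QuasiIso S.f where
  quasiIsoAt j := by
    rw [quasiIsoAt_iff_isIso_homologyMap]
    -- In the long exact homology sequence this map sits between H_{j+1} and H_j of the acyclic
    -- quotient.
    have : Mono (HomologicalComplex.homologyMap S.f j) :=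
      (hS.homology_exact₁ (j + 1) j (by simp)).mono_g
        ((h₃ (j + 1)).isZero_homology.eq_of_src _ _)
    have : Epi (HomologicalComplex.homologyMap S.f j) :=
      (hS.homology_exact₂ j).epi_f ((h₃ j).isZero_homology.eq_of_tgt _ _)
    exact isIso_of_mono_of_epi _

lemma quasiIso_g_of_acyclic {S : ShortComplex (ChainComplex A ℤ)} (hS : S.ShortExact)
    (h₁ : S.X₁.Acyclic) : QuasiIso S.g where
  quasiIsoAt j := by
    rw [quasiIsoAt_iff_isIso_homologyMap]
    have : Mono (HomologicalComplex.homologyMap S.g j) :=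
      (hS.homology_exact₂ j).mono_g ((h₁ j).isZero_homology.eq_of_src _ _)
    have : Epi (HomologicalComplex.homologyMap S.g j) :=
      (hS.homology_exact₃ j (j - 1) (by simp)).epi_f
        ((h₁ (j - 1)).isZero_homology.eq_of_tgt _ _)
    exact isIso_of_mono_of_epi _

lemma acyclic_of_quasiIso {K L : ChainComplex A ℤ} (f : K ⟶ L) [QuasiIso f] (h : K.Acyclic) :
    L.Acyclic := fun i => by
  rw [← exactAt_iff_of_quasiIsoAt f]
  exact h i

lemma acyclic_of_quasiIso' {K L : ChainComplex A ℤ} (f : K ⟶ L) [QuasiIso f] (h : L.Acyclic) :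
    K.Acyclic := fun i => by
  rw [exactAt_iff_of_quasiIsoAt f]
  exact h i

/-- Short exact sequences in an abelian category are stable under base change. -/
lemma exists_shortExact_of_isPullback {S : ShortComplex A} (hS : S.ShortExact) {P B : A}
    {a : P ⟶ B} {b : P ⟶ S.X₂} {h : B ⟶ S.X₃} (sq : IsPullback a b h S.g) :
    ∃ (j : S.X₁ ⟶ P) (w : j ≫ a = 0), (ShortComplex.mk j a w).ShortExact := by
  have := hS.mono_f
  have := hS.epi_g
  obtain ⟨j, w, hj⟩ : ∃ j : S.X₁ ⟶ P, j ≫ a = 0 ∧ j ≫ b = S.f :=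
    ⟨sq.lift 0 S.f (by simp), by simp, by simp⟩
  have hmono : Mono j := by
    have : Mono (j ≫ b) := by rwa [hj]
    exact mono_of_mono _ b
  have hepi : Epi a := Abelian.epi_fst_of_isLimit _ _ sq.isLimit
  have hlift {T : A} (x : T ⟶ P) (hx : x ≫ a = 0) : (x ≫ b) ≫ S.g = 0 := by
    rw [Category.assoc, ← sq.w, reassoc_of% hx, zero_comp]
  have hfac {T : A} (x : T ⟶ P) (hx : x ≫ a = 0) : hS.exact.lift (x ≫ b) (hlift x hx) ≫ j = x :=
    sq.hom_ext (by simp [w, hx]) (by simp [hj])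
  exact ⟨j, w, ⟨ShortComplex.exact_of_f_is_kernel _ (KernelFork.IsLimit.ofι _ _
    (fun x hx => hS.exact.lift (x ≫ b) (hlift x hx)) hfac
    (fun x hx m hm => by rw [← cancel_mono j, hm, hfac x hx]))⟩⟩

lemma shortExact_kernel {E D : A} (p : E ⟶ D) [Epi p] :
    (ShortComplex.mk (kernel.ι p) p (kernel.condition p)).ShortExact :=
  ⟨ShortComplex.exact_of_f_is_kernel _ (kernelIsKernel p)⟩

end ShortExact

/-! ### Weak equivalence -/

section WeakEquivalence

variable {D : Type u} [Category.{v} D] {W : MorphismProperty D}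

lemma WeaklyEquivalent.of {X Y : D} (f : X ⟶ Y) (hf : W f) : WeaklyEquivalent W X Y :=
  .rel _ _ ⟨f, hf⟩

lemma WeaklyEquivalent.refl (X : D) : WeaklyEquivalent W X X :=
  Relation.EqvGen.refl X

lemma WeaklyEquivalent.symm {X Y : D} (h : WeaklyEquivalent W X Y) : WeaklyEquivalent W Y X :=
  Relation.EqvGen.symm _ _ h

lemma WeaklyEquivalent.trans {X Y Z : D} (h : WeaklyEquivalent W X Y)
    (h' : WeaklyEquivalent W Y Z) : WeaklyEquivalent W X Z :=
  Relation.EqvGen.trans _ _ _ h h'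

/-- A function on objects which takes weakly equivalent pairs joined by one morphism to weakly
equivalent pairs preserves weak equivalence. -/
lemma WeaklyEquivalent.map {E : Type*} [Category* E] {W' : MorphismProperty E} (G : D → E)
    (hG : ∀ ⦃X Y : D⦄ (f : X ⟶ Y), W f → WeaklyEquivalent W' (G X) (G Y)) {X Y : D}
    (h : WeaklyEquivalent W X Y) : WeaklyEquivalent W' (G X) (G Y) := by
  induction h with
  | rel X Y h => exact hG h.choose h.choose_spec
  | refl X => exact .refl _
  | symm X Y _ ih => exact ih.symm
  | trans X Y Z _ _ ih₁ ih₂ => exact ih₁.trans ih₂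

end WeakEquivalence

/-! ### The path complex -/

section Path

/-- The differential of the path complex. -/
noncomputable def pathD {A : Type u} [Category.{v} A] [Abelian A] {X₂ X₁ X₀ : A}
    (d₁ : X₂ ⟶ X₁) (d₀ : X₁ ⟶ X₀) : X₂ ⊞ X₁ ⟶ X₁ ⊞ X₀ :=
  -(biprod.fst ≫ d₁ ≫ biprod.inl) + biprod.snd ≫ biprod.inl + biprod.snd ≫ d₀ ≫ biprod.inr

/-- The path complex is contractible: the contraction is `biprod.fst ≫ biprod.inr`. -/
lemma eq_comp_pathD {A : Type u} [Category.{v} A] [Abelian A] {X₃ X₂ X₁ X₀ : A}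
    (d₂ : X₃ ⟶ X₂) (d₁ : X₂ ⟶ X₁) (d₀ : X₁ ⟶ X₀) {T : A} (x : T ⟶ X₂ ⊞ X₁)
    (hx : x ≫ pathD d₁ d₀ = 0) : x = (x ≫ biprod.fst ≫ biprod.inr) ≫ pathD d₂ d₁ := by
  -- For x = (a, b) this coordinate says b = d a, and (a, d a) is the boundary of (0, a).
  have h₁ := hx =≫ biprod.fst
  have h₂ : x ≫ biprod.snd = x ≫ biprod.fst ≫ d₁ := by
    rw [← sub_eq_zero, ← neg_add_eq_sub]
    simpa [pathD] using h₁
  apply biprod.hom_ext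
  · simp [pathD]
  · simpa [pathD] using h₂

variable {R : Type r} [CommRing R]

/-- The acyclic complex of paths in `K`, with `(path K)_i = K_{i+1} ⊕ K_i`. -/
noncomputable def path (K : ChainComplex (ModuleCat.{w} R) ℤ) :
    ChainComplex (ModuleCat.{w} R) ℤ where
  X i := K.X (i + 1) ⊞ K.X i
  d i j := -(biprod.fst ≫ K.d (i + 1) (j + 1) ≫ biprod.inl) +
    -- The identity K_i → K_{j+1}, transported along i = j + 1 since `d` is asked for at all pairs
    -- of indices.
    biprod.snd ≫ (if h : i = j + 1 then eqToHom (by rw [h]) else 0) ≫ biprod.inl +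
    biprod.snd ≫ K.d i j ≫ biprod.inr
  shape i j hij := by
    simp only [ComplexShape.down_Rel] at hij
    rw [K.shape i j (by simpa using hij), K.shape (i + 1) (j + 1) (by simp; omega), dif_neg (by omega)]
    simp
  d_comp_d' i j l hij hjl := by
    simp only [ComplexShape.down_Rel] at hij hjl
    subst hij
    subst hjl
    ext : 1
    all_goals simp

lemma path_d (K : ChainComplex (ModuleCat.{w} R) ℤ) (j : ℤ) :
    (path K).d (j + 1) j = pathD (K.d (j + 1 + 1) (j + 1)) (K.d (j + 1) j) := by
  simp [path, pathD]

/-- The projection of a path to its end point. -/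
noncomputable def pathπ (K : ChainComplex (ModuleCat.{w} R) ℤ) : path K ⟶ K where
  f i := biprod.snd
  comm' i j _ := by simp [path]

/-- The inclusion of the loops into the paths. -/
noncomputable def loopι (K : ChainComplex (ModuleCat.{w} R) ℤ) : loop K ⟶ path K where
  f i := biprod.inl
  comm' i j _ := by simp [path, loop]

lemma loopι_comp_pathπ (K : ChainComplex (ModuleCat.{w} R) ℤ) : loopι K ≫ pathπ K = 0 := by
  ext1 i
  exact biprod.inl_snd

lemma shortExact_loop_path (K : ChainComplex (ModuleCat.{w} R) ℤ) :
    (ShortComplex.mk (loopι K) (pathπ K) (loopι_comp_pathπ K)).ShortExact := by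
  apply HomologicalComplex.shortExact_of_degreewise_shortExact
  intro i
  exact (ShortComplex.Splitting.ofHasBinaryBiproduct (K.X (i + 1)) (K.X i)).shortExact

lemma acyclic_path (K : ChainComplex (ModuleCat.{w} R) ℤ) : (path K).Acyclic := by
  intro i
  obtain ⟨i, rfl⟩ : ∃ j, i = j + 1 := ⟨i - 1, by simp⟩
  rw [HomologicalComplex.exactAt_iff' _ (i + 1 + 1) (i + 1) i (by simp) (by simp),
    ShortComplex.exact_iff_exact_up_to_refinements]
  intro T x hx
  replace hx : x ≫ (path K).d (i + 1) i = 0 := hx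
  rw [path_d] at hx
  have h := eq_comp_pathD (K.d (i + 1 + 1 + 1) (i + 1 + 1)) _ _ x hx
  rw [← path_d] at h
  exact ⟨T, 𝟙 T, inferInstance, _, (Category.id_comp x).trans h⟩

/-- If `E` is acyclic and `E ⟶ K` is levelwise surjective, then the kernel is weakly equivalent
to the loop complex of `K`. -/
lemma weaklyEquivalent_loop {S : ShortComplex (ChainComplex (ModuleCat.{w} R) ℤ)}
    (hS : S.ShortExact) (h₂ : S.X₂.Acyclic) :
    WeaklyEquivalent (HomologicalComplex.quasiIso (ModuleCat.{w} R) (ComplexShape.down ℤ))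
      S.X₁ (loop S.X₃) := by
  have sq := IsPullback.of_hasPullback (pathπ S.X₃) S.g
  obtain ⟨j, wj, hj⟩ := exists_shortExact_of_isPullback hS sq
  obtain ⟨l, wl, hl⟩ := exists_shortExact_of_isPullback (shortExact_loop_path S.X₃) sq.flip
  exact (WeaklyEquivalent.of j (quasiIso_f_of_acyclic hj (acyclic_path _))).trans
    (WeaklyEquivalent.of l (quasiIso_f_of_acyclic hl h₂)).symm

/-! ### Loops preserve quasi-isomorphisms -/

/-- The short complex with opposite differentials. -/
abbrev negShortComplex {A : Type u} [Category.{v} A] [Preadditive A] (S : ShortComplex A) :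
    ShortComplex A where
  f := -S.f
  g := -S.g
  zero := by simp

/-- A short complex is isomorphic to the one with opposite differentials. -/
abbrev negShortComplexIso {A : Type u} [Category.{v} A] [Preadditive A] (S : ShortComplex A) :
    S ≅ negShortComplex S where
  hom := { τ₁ := 𝟙 _, τ₂ := -𝟙 _, τ₃ := 𝟙 _ }
  inv := { τ₁ := 𝟙 _, τ₂ := -𝟙 _, τ₃ := 𝟙 _ }

/-- The morphism with the same components between short complexes with opposite differentials. -/
abbrev negMap {A : Type u} [Category.{v} A] [Preadditive A] {S T : ShortComplex A} (φ : S ⟶ T) :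
    negShortComplex S ⟶ negShortComplex T where
  τ₁ := φ.τ₁
  τ₂ := φ.τ₂
  τ₃ := φ.τ₃
  comm₁₂ := by simpa using φ.comm₁₂
  comm₂₃ := by simpa using φ.comm₂₃

/-- Changing the sign of the middle term identifies `negMap φ` with `φ` as an arrow. -/
lemma quasiIso_negMap {A : Type u} [Category.{v} A] [Abelian A] {S T : ShortComplex A}
    (φ : S ⟶ T) [hφ : ShortComplex.QuasiIso φ] : ShortComplex.QuasiIso (negMap φ) := by
  refine (ShortComplex.quasiIso_iff_of_arrow_mk_iso _ _ ?_).1 hφ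
  exact Arrow.isoMk (negShortComplexIso S) (negShortComplexIso T) (by ext <;> simp)

/-- The morphism of loop complexes induced by a morphism of complexes. -/
def loopMap {K L : ChainComplex (ModuleCat.{w} R) ℤ} (f : K ⟶ L) : loop K ⟶ loop L where
  f i := f.f (i + 1)
  comm' i j _ := by simp [loop]

lemma quasiIso_loopMap {K L : ChainComplex (ModuleCat.{w} R) ℤ} (f : K ⟶ L) [hf : QuasiIso f] :
    QuasiIso (loopMap f) where
  quasiIsoAt i := by
    have h := hf.quasiIsoAt (i + 1)
    -- Writing the last index as i - 1 + 1 makes the negated short complex definitionally that of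
    -- the loop complex at i.
    rw [quasiIsoAt_iff' _ (i + 1 + 1) (i + 1) (i - 1 + 1) (by simp) (by simp)] at h
    rw [quasiIsoAt_iff' _ (i + 1) i (i - 1) (by simp) (by simp)]
    exact quasiIso_negMap _ (hφ := h)

lemma WeaklyEquivalent.loop {K L : ChainComplex (ModuleCat.{w} R) ℤ}
    (h : WeaklyEquivalent
      (HomologicalComplex.quasiIso (ModuleCat.{w} R) (ComplexShape.down ℤ)) K L) :
    WeaklyEquivalent (HomologicalComplex.quasiIso (ModuleCat.{w} R) (ComplexShape.down ℤ))
      (Deloop.loop K) (Deloop.loop L) := by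
  exact h.map _ fun K L f (hf : QuasiIso f) => .of (loopMap f) (quasiIso_loopMap f)

lemma WeaklyEquivalent.loop_iterate {K L : ChainComplex (ModuleCat.{w} R) ℤ}
    (h : WeaklyEquivalent
      (HomologicalComplex.quasiIso (ModuleCat.{w} R) (ComplexShape.down ℤ)) K L) (n : ℕ) :
    WeaklyEquivalent (HomologicalComplex.quasiIso (ModuleCat.{w} R) (ComplexShape.down ℤ))
      (Deloop.loop^[n] K) (Deloop.loop^[n] L) := by
  induction n with
  | zero => exact h
  | succ n ih =>
    rw [Function.iterate_succ_apply', Function.iterate_succ_apply']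
    exact ih.loop

/-! ### Homotopy cartesian squares of complexes -/

variable {A B C D : ChainComplex (ModuleCat.{w} R) ℤ} {f : A ⟶ B} {g : A ⟶ C} {h : B ⟶ D}
  {l : C ⟶ D}

/-- The surjections `a` and `p` have the same kernel, and each is a quasi-isomorphism exactly when
that kernel is acyclic. -/
lemma IsHomotopyCartesian.quasiIso (H : IsHomotopyCartesian f g h l) [QuasiIso f] :
    QuasiIso l := by
  obtain ⟨-, C', P, i, p, a, b, q, rfl, hi, hp, sq, rfl, -, hq⟩ := H
  have : Epi p := HomologicalComplex.epi_of_epi_f p hp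
  have : QuasiIso a := quasiIso_of_comp_left q a
  obtain ⟨j, w, hj⟩ := exists_shortExact_of_isPullback (shortExact_kernel p) sq
  have : QuasiIso p := quasiIso_g_of_acyclic (shortExact_kernel p) (hj.acyclic_X₁ this)
  infer_instance

/-- A ≃ P ≃ ker p ≃ ΩD: the middle step uses that ker p is also the kernel of P → B with B acyclic,
the last that C' is acyclic. -/
lemma IsHomotopyCartesian.weaklyEquivalent_loop (H : IsHomotopyCartesian f g h l)
    (hB : B.Acyclic) (hC : C.Acyclic) :
    WeaklyEquivalent (HomologicalComplex.quasiIso (ModuleCat.{w} R) (ComplexShape.down ℤ))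
      A (loop D) := by
  obtain ⟨-, C', P, i, p, a, b, q, rfl, hi, hp, sq, -, -, hq⟩ := H
  have : Epi p := HomologicalComplex.epi_of_epi_f p hp
  obtain ⟨j, w, hj⟩ := exists_shortExact_of_isPullback (shortExact_kernel p) sq
  exact ((WeaklyEquivalent.of q hq).trans
    (WeaklyEquivalent.of j (quasiIso_f_of_acyclic hj hB)).symm).trans
      (Deloop.weaklyEquivalent_loop (shortExact_kernel p) (acyclic_of_quasiIso i hC))

end Path

/-! ### Pushouts and suspensions over `η` -/

section Model

variable {C : Type u} [Category.{v} C] [ModelCategory C] {k B : C} {η : k ⟶ B}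

lemma cofibration_iff_h {X Y : Factorisation η} (f : X ⟶ Y) :
    Cofibration f ↔ Cofibration f.h := by
  rw [cofibration_iff, cofibration_iff]
  rfl

lemma weakEquivalence_iff_h {X Y : Factorisation η} (f : X ⟶ Y) :
    WeakEquivalence f ↔ WeakEquivalence f.h := by
  rw [weakEquivalence_iff, weakEquivalence_iff]
  rfl

lemma weakEquivalence_id (X : Factorisation η) : WeakEquivalence (𝟙 X) :=
  (weakEquivalence_iff_h _).2 (inferInstanceAs (WeakEquivalence (𝟙 X.mid)))

lemma cofibration_id (X : Factorisation η) : Cofibration (𝟙 X) :=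
  (cofibration_iff_h _).2 (inferInstanceAs (Cofibration (𝟙 X.mid)))

lemma weakEquivalence_comp {X Y Z : Factorisation η} (f : X ⟶ Y) (g : Y ⟶ Z)
    [hf : WeakEquivalence f] [hg : WeakEquivalence g] : WeakEquivalence (f ≫ g) := by
  rw [weakEquivalence_iff_h] at *
  exact inferInstanceAs (WeakEquivalence (f.h ≫ g.h))

/-- The chosen initial object is only isomorphic to k = k → B, and cofibrations absorb that
isomorphism. -/
lemma isCofibrant_iff_ι (X : Factorisation η) : IsCofibrant X ↔ Cofibration X.ι := by
  have : IsIso (initial.to (Factorisation.initial : Factorisation η)) :=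
    isIso_of_isInitial initialIsInitial Factorisation.IsInitial_initial _
  let j : (⊥_ (Factorisation η)).mid ⟶ k :=
    (initial.to (Factorisation.initial : Factorisation η)).h
  have hj : IsIso j := inferInstanceAs (IsIso (Factorisation.forget.map
    (initial.to (Factorisation.initial : Factorisation η))))
  have h : (initial.to X).h = j ≫ X.ι :=
    congrArg Factorisation.Hom.h
      (initialIsInitial.hom_ext (initial.to X) (initial.to _ ≫ Factorisation.initialHom X))
  rw [isCofibrant_iff, cofibration_iff_h, h, cofibration_iff, cofibration_iff]
  exact (cofibrations C).cancel_left_of_respectsIso j X.ι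

/-- Every morphism over `η` factors as a cofibration followed by a weak equivalence. -/
lemma exists_factorization {X Y : Factorisation η} (f : X ⟶ Y) :
    ∃ (Z : Factorisation η) (i : X ⟶ Z) (p : Z ⟶ Y),
      i ≫ p = f ∧ Cofibration i ∧ WeakEquivalence p := by
  let d := MorphismProperty.factorizationData (cofibrations C) (trivialFibrations C) f.h
  let Z : Factorisation η := ⟨d.Z, X.ι ≫ d.i, d.p ≫ Y.π, by simp⟩
  refine ⟨Z, ⟨d.i, rfl, ?_⟩, ⟨d.p, ?_, rfl⟩, ?_, ?_, ?_⟩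
  · simp [Z]
  · simp [Z]
  · exact Factorisation.Hom.ext d.fac
  · exact (cofibration_iff_h _).2 ⟨d.hi⟩
  · exact (weakEquivalence_iff_h _).2 ⟨d.hp.2⟩

/-- Every object over `η` has a cofibrant replacement. -/
lemma exists_cofibrant (X : Factorisation η) :
    ∃ (X' : Factorisation η) (p : X' ⟶ X), IsCofibrant X' ∧ WeakEquivalence p := by
  obtain ⟨Z, i, p, -, hi, hp⟩ :=
    exists_factorization (Factorisation.initialHom X : Factorisation.initial ⟶ X)
  refine ⟨Z, p, ?_, hp⟩
  rw [isCofibrant_iff_ι]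
  have h : i.h = Z.ι := (Category.id_comp i.h).symm.trans i.ι_h
  rwa [cofibration_iff_h, h] at hi

lemma nonempty_spanReplacement {X Y Z : Factorisation η} (f : X ⟶ Y) (g : X ⟶ Z) :
    Nonempty (SpanReplacement f g) := by
  obtain ⟨X', p, hX', hp⟩ := exists_cofibrant X
  obtain ⟨Y', f', wY, hf, hf', hwY⟩ := exists_factorization (p ≫ f)
  obtain ⟨Z', g', wZ, hg, hg', hwZ⟩ := exists_factorization (p ≫ g)
  exact ⟨⟨X', Y', Z', f', g', p, wY, wZ, hf, hg, hX', hf', hg', hp, hwY, hwZ⟩⟩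

/-- Pushouts over `η` are formed in the underlying category. -/
lemma exists_isPushout {X Y Z : Factorisation η} (f : X ⟶ Y) (g : X ⟶ Z) :
    ∃ (P : Factorisation η) (inl : Y ⟶ P) (inr : Z ⟶ P), IsPushout f g inl inr := by
  obtain ⟨Q, i, j, sq⟩ : ∃ (Q : C) (i : Y.mid ⟶ Q) (j : Z.mid ⟶ Q), IsPushout f.h g.h i j :=
    ⟨_, _, _, IsPushout.of_hasPushout f.h g.h⟩
  let P : Factorisation η := ⟨Q, Y.ι ≫ i, sq.desc Y.π Z.π (by simp), by simp⟩
  have hι : Z.ι ≫ j = Y.ι ≫ i := by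
    rw [← f.ι_h, ← g.ι_h, Category.assoc, Category.assoc, sq.w]
  let inl : Y ⟶ P := ⟨i, rfl, sq.inl_desc _ _ _⟩
  let inr : Z ⟶ P := ⟨j, hι, sq.inr_desc _ _ _⟩
  have w : f ≫ inl = g ≫ inr := Factorisation.Hom.ext sq.w
  have hs (s : PushoutCocone f g) : f.h ≫ s.inl.h = g.h ≫ s.inr.h :=
    congrArg Factorisation.Hom.h s.condition
  refine ⟨P, inl, inr, ⟨⟨w⟩, ⟨PushoutCocone.IsColimit.mk _
    (fun s => ⟨sq.desc s.inl.h s.inr.h (hs s), ?_, ?_⟩) ?_ ?_ ?_⟩⟩⟩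
  · simp [P]
  · apply sq.hom_ext <;> simp [P]
  · exact fun s => Factorisation.Hom.ext (sq.inl_desc _ _ _)
  · exact fun s => Factorisation.Hom.ext (sq.inr_desc _ _ _)
  · intro s m h₁ h₂
    apply Factorisation.Hom.ext
    apply sq.hom_ext
    · exact (congrArg Factorisation.Hom.h h₁).trans (sq.inl_desc _ _ _).symm
    · exact (congrArg Factorisation.Hom.h h₂).trans (sq.inr_desc _ _ _).symm

lemma exists_isSuspension (X : Factorisation η) : ∃ Y, IsSuspension X Y := by
  obtain ⟨S⟩ := nonempty_spanReplacement (Factorisation.IsTerminal_terminal.from X)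
    (Factorisation.IsTerminal_terminal.from X)
  obtain ⟨P, inl, inr, h⟩ := exists_isPushout S.f' S.g'
  exact ⟨P, S, P, inl, inr, h, .refl P⟩

lemma exists_isIteratedSuspension (n : ℕ) (X : Factorisation η) :
    ∃ Y, IsIteratedSuspension n X Y := by
  induction n with
  | zero => exact ⟨X, rfl⟩
  | succ n ih =>
    obtain ⟨Z, hZ⟩ := ih
    obtain ⟨Y, hY⟩ := exists_isSuspension Z
    exact ⟨Y, Z, hZ, hY⟩

/-- A pushout of two cofibrations out of a cofibrant object is homotopy cocartesian. -/
lemma isHomotopyCocartesian_of_isPushout {X Y Z P : Factorisation η} {f : X ⟶ Y} {g : X ⟶ Z}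
    {inl : Y ⟶ P} {inr : Z ⟶ P} (sq : IsPushout f g inl inr) (hX : IsCofibrant X)
    (hf : Cofibration f) (hg : Cofibration g) : IsHomotopyCocartesian f g inl inr :=
  ⟨sq.toCommSq, ⟨X, Y, Z, f, g, 𝟙 X, 𝟙 Y, 𝟙 Z, by simp, by simp, hX, hf, hg,
    weakEquivalence_id X, weakEquivalence_id Y, weakEquivalence_id Z⟩,
    P, inl, inr, 𝟙 P, sq, by simp, by simp, weakEquivalence_id P⟩

/-- The square on two identities and twice the weak equivalence `f` is homotopy cocartesian. -/
lemma isHomotopyCocartesian_id {X Y : Factorisation η} (f : X ⟶ Y) [WeakEquivalence f] :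
    IsHomotopyCocartesian (𝟙 X) (𝟙 X) f f := by
  obtain ⟨X', p, hX', hp⟩ := exists_cofibrant X
  exact ⟨⟨rfl⟩, ⟨X', X', X', 𝟙 X', 𝟙 X', p, p, p, by simp, by simp, hX', cofibration_id X',
    cofibration_id X', hp, hp, hp⟩, X', 𝟙 X', 𝟙 X', p ≫ f, IsPushout.of_id_fst, by simp, by simp,
    weakEquivalence_comp p f⟩

/-! ### Excisive functors and suspension -/

variable {R : Type r} [CommRing R] {F : Factorisation η ⥤ ChainComplex (ModuleCat.{w} R) ℤ}

/-- A 1-excisive functor takes weak equivalences to quasi-isomorphisms. -/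
lemma IsOneExcisive.quasiIso_map (hF : IsOneExcisive F) {X Y : Factorisation η} (f : X ⟶ Y)
    [WeakEquivalence f] : QuasiIso (F.map f) :=
  (hF _ _ _ _ (isHomotopyCocartesian_id f)).quasiIso

lemma IsOneExcisive.weaklyEquivalent_obj (hF : IsOneExcisive F) {X Y : Factorisation η}
    (h : WeaklyEquivalent (weakEquivalences (Factorisation η)) X Y) :
    WeaklyEquivalent (HomologicalComplex.quasiIso (ModuleCat.{w} R) (ComplexShape.down ℤ))
      (F.obj X) (F.obj Y) :=
  h.map F.obj fun _ _ f hf =>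
    have : WeakEquivalence f := ⟨hf⟩
    .of (F.map f) (hF.quasiIso_map f)

lemma IsOneExcisive.weaklyEquivalent_loop (hF : IsOneExcisive F) (hF₀ : IsReduced F)
    {X Y : Factorisation η} (h : IsSuspension X Y) :
    WeaklyEquivalent (HomologicalComplex.quasiIso (ModuleCat.{w} R) (ComplexShape.down ℤ))
      (F.obj X) (loop (F.obj Y)) := by
  obtain ⟨S, P, inl, inr, sq, hP⟩ := h
  have := S.weakEquivalence_wX
  have := S.weakEquivalence_wY
  have := S.weakEquivalence_wZ
  have := hF.quasiIso_map S.wY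
  have := hF.quasiIso_map S.wZ
  have H := hF _ _ _ _ (isHomotopyCocartesian_of_isPushout sq S.isCofibrant S.cofibration_f'
    S.cofibration_g')
  exact ((WeaklyEquivalent.of (F.map S.wX) (hF.quasiIso_map S.wX)).symm.trans
    (H.weaklyEquivalent_loop (acyclic_of_quasiIso' (F.map S.wY) hF₀)
      (acyclic_of_quasiIso' (F.map S.wZ) hF₀))).trans (hF.weaklyEquivalent_obj hP).loop

lemma IsOneExcisive.weaklyEquivalent_loop_iterate (hF : IsOneExcisive F) (hF₀ : IsReduced F)
    (n : ℕ) {X Y : Factorisation η} (h : IsIteratedSuspension n X Y) :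
    WeaklyEquivalent (HomologicalComplex.quasiIso (ModuleCat.{w} R) (ComplexShape.down ℤ))
      (F.obj X) (loop^[n] (F.obj Y)) := by
  induction n generalizing Y with
  | zero =>
    obtain rfl : X = Y := h
    exact .refl _
  | succ n ih =>
    obtain ⟨Z, hZ, hY⟩ := h
    -- The new loop goes innermost, where it meets F(Z) ≃ ΩF(Y).
    rw [Function.iterate_succ_apply]
    exact (ih hZ).trans ((hF.weaklyEquivalent_loop hF₀ hY).loop_iterate n)

end Model

end Deloop

theorem mainTheorem7 {C : Type u} [Category.{v} C] [ModelCategory C] {k B : C} (η : k ⟶ B)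
    {R : Type r} [CommRing R] (F : Factorisation η ⥤ ChainComplex (ModuleCat.{w} R) ℤ)
    (hF₀ : Deloop.IsReduced F) (hF₁ : Deloop.IsOneExcisive F)
    (X : Factorisation η) (n : ℕ) (hn : 1 ≤ n) :
    (∃ Y : Factorisation η, Deloop.IsIteratedSuspension n X Y) ∧
      ∀ Y : Factorisation η, Deloop.IsIteratedSuspension n X Y →
        Deloop.WeaklyEquivalent
          (HomologicalComplex.quasiIso (ModuleCat.{w} R) (ComplexShape.down ℤ))
          (F.obj X) (Deloop.loop^[n] (F.obj Y)) :=
  ⟨Deloop.exists_isIteratedSuspension n X,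
    fun _ hY => hF₁.weaklyEquivalent_loop_iterate hF₀ n hY⟩
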